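/- Let $M$ be a non-empty smooth (Hausdorff, second countable) 6-manifold with a smooth Riemannian metric $g$ and a smooth almost complex structure $J$ with $g(JX,JY)=g(X,Y)$, let $\omega(X,Y)=g(JX,Y)$ be its Kähler form, and orient $M$ by $J$. Let $A^+_\omega$ be the set of all smooth almost complex structures $I$ on $M$ that induce the same orientation as $J$ and satisfy $\omega(IX,IY)=\omega(X,Y)$ for all $X,Y$ and $\omega(X,IX)>0$ for all $X\neq 0$. (a) Suppose that $(M,g,J,\omega)$ is strictly nearly Kähler, i.e. $(\nabla_XJ)X=0$ for every vector field $X$ and $\nabla_vJ\neq 0$ for every non-zero tangent vector $v$, where $\nabla$ is the Levi-Civita connection of $g$. Then every $I\in A^+_\omega$ is non-integrable: $I$ is not induced by a complex manifold structure on $M$, and its Nijenhuis tensor $N_I(X,Y)=[IX,IY]-I[IX,Y]-I[X,IY]-[X,Y]$ does not vanish identically. (b) More generally, for an almost Hermitian 6-manifold $(M,g,J,\omega)$ as above, the same conclusion holds for every $I\in A^+_\omega$ if $d\omega$ is not identically zero and is of type $(3,0)+(0,3)$ with respect to $J$. -/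

import Mathlib

open Bundle Manifold
open scoped ContDiff

noncomputable section

/-- The model space of a real 6-dimensional manifold. -/
abbrev E6 : Type := EuclideanSpace ℝ (Fin 6)

section Integrability

variable (M : Type*) [TopologicalSpace M] [ChartedSpace E6 M] [IsManifold (𝓡 6) ∞ M]

variable {M} in
/-- The vector field `X` is differentiable at `x`. -/
def DiffFieldAt (X : ∀ x : M, TangentSpace (𝓡 6) x) (x : M) : Prop :=
  MDifferentiableAt (𝓡 6) ((𝓡 6).prod 𝓘(ℝ, E6)) (fun y ↦ TotalSpace.mk' E6 y (X y)) x

/-- A (smooth) almost complex structure on a smooth 6-manifold `M`: a smooth section of the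
endomorphism bundle of the tangent bundle, with square `-1`. -/
structure AlmostComplexStructure where
  /-- the endomorphism of each tangent space -/
  toFun : ∀ x : M, TangentSpace (𝓡 6) x →L[ℝ] TangentSpace (𝓡 6) x
  contMDiff_toFun : ContMDiff (𝓡 6) ((𝓡 6).prod 𝓘(ℝ, E6 →L[ℝ] E6)) ∞
    (fun x ↦ TotalSpace.mk' (E6 →L[ℝ] E6)
      (E := fun x : M ↦ TangentSpace (𝓡 6) x →L[ℝ] TangentSpace (𝓡 6) x) x (toFun x))
  sq_eq_neg : ∀ (x : M) (v : TangentSpace (𝓡 6) x), toFun x (toFun x v) = -v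

namespace AlmostComplexStructure

instance : CoeFun (AlmostComplexStructure M)
    (fun _ ↦ ∀ x : M, TangentSpace (𝓡 6) x →L[ℝ] TangentSpace (𝓡 6) x) := ⟨toFun⟩

variable {M}

/-- `J` is integrable if it is induced by a complex manifold structure: around every point there is
a smooth chart with values in `ℂ³` whose differential carries `J` to multiplication by `i`. -/
def IsIntegrable (J : AlmostComplexStructure M) : Prop :=
  ∀ x : M, ∃ φ : OpenPartialHomeomorph M (Fin 3 → ℂ),
    x ∈ φ.source ∧
    ContMDiffOn (𝓡 6) 𝓘(ℝ, Fin 3 → ℂ) ∞ φ φ.source ∧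
    ContMDiffOn 𝓘(ℝ, Fin 3 → ℂ) (𝓡 6) ∞ φ.symm φ.target ∧
    ∀ y ∈ φ.source, ∀ v : TangentSpace (𝓡 6) y,
      mfderiv (𝓡 6) 𝓘(ℝ, Fin 3 → ℂ) φ y (J y v) =
        (Complex.I • (show Fin 3 → ℂ from mfderiv (𝓡 6) 𝓘(ℝ, Fin 3 → ℂ) φ y v) : Fin 3 → ℂ)

/-- The vector field `J X`. -/
def applyField (J : AlmostComplexStructure M) (X : ∀ x : M, TangentSpace (𝓡 6) x) :
    ∀ x : M, TangentSpace (𝓡 6) x := fun x ↦ J x (X x)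

/-- The Nijenhuis tensor `N_J(X, Y) = [JX, JY] - J[JX, Y] - J[X, JY] - [X, Y]` at `x`. -/
def nijenhuis (J : AlmostComplexStructure M) (X Y : ∀ x : M, TangentSpace (𝓡 6) x) (x : M) :
    TangentSpace (𝓡 6) x :=
  VectorField.mlieBracket (𝓡 6) (J.applyField X) (J.applyField Y) x
    - J x (VectorField.mlieBracket (𝓡 6) (J.applyField X) Y x)
    - J x (VectorField.mlieBracket (𝓡 6) X (J.applyField Y) x)
    - VectorField.mlieBracket (𝓡 6) X Y x

/-- The Nijenhuis tensor of `J` vanishes identically. (It is tensorial, so that it may be tested on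
vector fields that are differentiable at the point in question.) -/
def NijenhuisVanishes (J : AlmostComplexStructure M) : Prop :=
  ∀ (x : M) (X Y : ∀ x : M, TangentSpace (𝓡 6) x),
    DiffFieldAt X x → DiffFieldAt Y x → J.nijenhuis X Y x = 0

/-- The complex-valued alternating 3-form `β` on `T_xM` is of type `(3,0)` with respect to `J`:
it is complex linear in every argument. -/
def IsType30 (J : AlmostComplexStructure M) {x : M}
    (β : TangentSpace (𝓡 6) x [⋀^Fin 3]→ₗ[ℝ] ℂ) : Prop :=
  ∀ (v : Fin 3 → TangentSpace (𝓡 6) x) (i : Fin 3),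
    β (Function.update v i (J x (v i))) = Complex.I * β v

/-- The complex-valued alternating 3-form `β` on `T_xM` is of type `(0,3)` with respect to `J`:
it is complex antilinear in every argument. -/
def IsType03 (J : AlmostComplexStructure M) {x : M}
    (β : TangentSpace (𝓡 6) x [⋀^Fin 3]→ₗ[ℝ] ℂ) : Prop :=
  ∀ (v : Fin 3 → TangentSpace (𝓡 6) x) (i : Fin 3),
    β (Function.update v i (J x (v i))) = -Complex.I * β v

/-- A real basis of `T_xM` of the form `(e₁, Je₁, e₂, Je₂, e₃, Je₃)`. -/
def IsAdaptedBasis (J : AlmostComplexStructure M) {x : M}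
    (b : Module.Basis (Fin 3 × Fin 2) ℝ (TangentSpace (𝓡 6) x)) : Prop :=
  ∀ k : Fin 3, b (k, 1) = J x (b (k, 0))

/-- `J` and `J'` induce the same orientation of `M`, the orientation induced by `J` being the one
for which the bases `(e₁, Je₁, e₂, Je₂, e₃, Je₃)` are positive. -/
def SameOrientation (J J' : AlmostComplexStructure M) : Prop :=
  ∀ (x : M) (b b' : Module.Basis (Fin 3 × Fin 2) ℝ (TangentSpace (𝓡 6) x)),
    J.IsAdaptedBasis b → J'.IsAdaptedBasis b' → b.orientation = b'.orientation

end AlmostComplexStructure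

end Integrability

section Hermitian

variable {M : Type*} [TopologicalSpace M] [ChartedSpace E6 M] [IsManifold (𝓡 6) ∞ M]
  [RiemannianBundle (fun x : M ↦ TangentSpace (𝓡 6) x)]

namespace AlmostComplexStructure

/-- `(g, J)` is an almost Hermitian structure: `g(JX, JY) = g(X, Y)`. -/
def IsAlmostHermitian (J : AlmostComplexStructure M) : Prop :=
  ∀ (x : M) (v w : TangentSpace (𝓡 6) x), inner ℝ (J x v) (J x w) = inner ℝ v w

/-- The Kähler form `ω(X, Y) = g(JX, Y)`. -/
def kahlerForm (J : AlmostComplexStructure M) (x : M) (v w : TangentSpace (𝓡 6) x) : ℝ :=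
  inner ℝ (J x v) w

/-- The set `A⁺_ω` of the positively oriented almost complex structures `I` (those inducing the
same orientation as `J`) with `ω(IX, IY) = ω(X, Y)` for all `X`, `Y`, and `ω(X, IX) > 0` for all
`X ≠ 0`, where `ω` is the Kähler form of `(g, J)`. -/
def positiveTamed (J : AlmostComplexStructure M) : Set (AlmostComplexStructure M) :=
  {I | J.SameOrientation I ∧
    (∀ (x : M) (v w : TangentSpace (𝓡 6) x),
      J.kahlerForm x (I x v) (I x w) = J.kahlerForm x v w) ∧
    ∀ (x : M) (v : TangentSpace (𝓡 6) x), v ≠ 0 → 0 < J.kahlerForm x v (I x v)}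

/-- The value at `x` of `X(ω(Y, Z))`. -/
def derivKahlerForm (J : AlmostComplexStructure M) (X Y Z : ∀ x : M, TangentSpace (𝓡 6) x)
    (x : M) : ℝ :=
  mvfderiv (𝓡 6) (fun y ↦ J.kahlerForm y (Y y) (Z y)) x (X x)

/-- The exterior derivative of the Kähler form on vector fields (differentiable at `x`), at `x`:
`dω(X, Y, Z) = X(ω(Y,Z)) - Y(ω(X,Z)) + Z(ω(X,Y)) - ω([X,Y],Z) + ω([X,Z],Y) - ω([Y,Z],X)`. -/
def dKahlerForm (J : AlmostComplexStructure M) (X Y Z : ∀ x : M, TangentSpace (𝓡 6) x)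
    (x : M) : ℝ :=
  J.derivKahlerForm X Y Z x - J.derivKahlerForm Y X Z x + J.derivKahlerForm Z X Y x
    - J.kahlerForm x (VectorField.mlieBracket (𝓡 6) X Y x) (Z x)
    + J.kahlerForm x (VectorField.mlieBracket (𝓡 6) X Z x) (Y x)
    - J.kahlerForm x (VectorField.mlieBracket (𝓡 6) Y Z x) (X x)

/-- `dω` is of type `(3,0) + (0,3)` with respect to `J`: at every point it is the sum of a form of
type `(3,0)` and a form of type `(0,3)`. -/
def DKahlerFormIsPureType (J : AlmostComplexStructure M) : Prop :=
  ∀ x : M, ∃ β γ : TangentSpace (𝓡 6) x [⋀^Fin 3]→ₗ[ℝ] ℂ, J.IsType30 β ∧ J.IsType03 γ ∧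
    ∀ X Y Z : ∀ x : M, TangentSpace (𝓡 6) x,
      DiffFieldAt X x → DiffFieldAt Y x → DiffFieldAt Z x →
        (J.dKahlerForm X Y Z x : ℂ) = β ![X x, Y x, Z x] + γ ![X x, Y x, Z x]

/-- `dω` is not identically zero. -/
def DKahlerFormNeZero (J : AlmostComplexStructure M) : Prop :=
  ∃ (x : M) (X Y Z : ∀ x : M, TangentSpace (𝓡 6) x),
    DiffFieldAt X x ∧ DiffFieldAt Y x ∧ DiffFieldAt Z x ∧ J.dKahlerForm X Y Z x ≠ 0

/-- `(∇_v J) Y = ∇_v (J Y) - J (∇_v Y)` at `x`, for `v ∈ T_xM` and a vector field `Y` that is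
differentiable at `x`. -/
def covDeriv (J : AlmostComplexStructure M)
    (nabla : CovariantDerivative (𝓡 6) E6 (fun x : M ↦ TangentSpace (𝓡 6) x))
    (x : M) (v : TangentSpace (𝓡 6) x) (Y : ∀ x : M, TangentSpace (𝓡 6) x) :
    TangentSpace (𝓡 6) x :=
  nabla (J.applyField Y) x v - J x (nabla Y x v)

/-- `(M, g, J)`, with Levi-Civita connection `∇`, is strictly nearly Kähler: it is almost Hermitian,
`(∇_X J) X = 0` for all `X`, and `∇_v J ≠ 0` for every non-zero tangent vector `v`. -/
structure IsStrictlyNearlyKahler (J : AlmostComplexStructure M)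
    (nabla : CovariantDerivative (𝓡 6) E6 (fun x : M ↦ TangentSpace (𝓡 6) x)) : Prop where
  isAlmostHermitian : J.IsAlmostHermitian
  covDeriv_self : ∀ (x : M) (X : ∀ x : M, TangentSpace (𝓡 6) x),
    DiffFieldAt X x → J.covDeriv nabla x (X x) X = 0
  covDeriv_ne_zero : ∀ (x : M) (v : TangentSpace (𝓡 6) x), v ≠ 0 →
    ∃ Y : ∀ x : M, TangentSpace (𝓡 6) x, DiffFieldAt Y x ∧ J.covDeriv nabla x v Y ≠ 0

end AlmostComplexStructure

/-- `∇` is the Levi-Civita connection of the Riemannian metric `g` of `M`: it is compatible with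
`g` and torsion-free. -/
def IsLeviCivita [IsContMDiffRiemannianBundle (𝓡 6) ∞ E6 (fun x : M ↦ TangentSpace (𝓡 6) x)]
    (nabla : CovariantDerivative (𝓡 6) E6 (fun x : M ↦ TangentSpace (𝓡 6) x)) : Prop :=
  haveI : IsContMDiffRiemannianBundle (𝓡 6) 1 E6 (fun x : M ↦ TangentSpace (𝓡 6) x) :=
    IsContMDiffRiemannianBundle.of_le (n := ∞) (by simp)
  nabla.IsMetricCompatible ∧ nabla.torsion = 0

end Hermitian

end

/-! ### Linear algebra on one tangent space. -/

section LinearAlgebra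

variable {V : Type*} [NormedAddCommGroup V]

/-! Suppose `N_I = 0`. Since `ω` is `I`-invariant, `dω` has no `(3,0) + (0,3)` part for `I`
(`dKahlerForm_eq_of_nijenhuisVanishes`). In both cases `dω` at a point is a trilinear form `T` in
which `J` may be moved from one argument to another, i.e. the real part of a `J`-complex form. These
two properties force `T = 0`, point by point.

Indeed, put `A = 1 - JI` and `B = 1 + JI`. The two properties together say `T(Ax, Ay, Az) = -T(Bx,
By, Bz)`, while tameness says `‖Bv‖ < ‖Av‖`. Comparing both sides where `|T|` is maximal on unit
vectors gives `T = 0` (`trilinear_eq_zero_of_tamed`).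

For pure type `dω` this contradicts `dω ≠ 0`. In the nearly Kähler case `dω = 3 g((∇J)·, ·)`, so
`∇J` would vanish at a point, contrary to strictness. An integrable `I` has `N_I = 0`, by naturality
of the Lie bracket in a complex chart. -/

theorem update_vec3_zero {α : Type*} (x y z a : α) : Function.update ![x, y, z] 0 a = ![a, y, z] := by
  ext i; fin_cases i <;> rfl

theorem update_vec3_one {α : Type*} (x y z a : α) : Function.update ![x, y, z] 1 a = ![x, a, z] := by
  ext i; fin_cases i <;> rfl

theorem update_vec3_two {α : Type*} (x y z a : α) : Function.update ![x, y, z] 2 a = ![x, y, a] := by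
  ext i; fin_cases i <;> rfl

/-- A trilinear form `T` with `T(Ax, Ay, Az) = -T(Bx, By, Bz)`, where `B` is everywhere strictly
smaller than `A`, vanishes: its maximum on unit vectors cannot be positive. -/
theorem trilinear_eq_zero_of_norm_lt [NormedSpace ℝ V] [FiniteDimensional ℝ V]
    (T : V →ₗ[ℝ] V →ₗ[ℝ] V →ₗ[ℝ] ℝ) (A B : V →ₗ[ℝ] V)
    (hAB : ∀ v, v ≠ 0 → ‖B v‖ < ‖A v‖)
    (hT : ∀ x y z, T (A x) (A y) (A z) = -T (B x) (B y) (B z)) : T = 0 := by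
  have hcont : Continuous fun p : V × V × V ↦ T p.1 p.2.1 p.2.2 := by
    -- Expanding the first argument in a basis reduces continuity to that of bilinear maps.
    let b := Module.finBasis ℝ V
    have h : ∀ p : V × V × V, T p.1 p.2.1 p.2.2 =
        ∑ i, b.coord i p.1 * (T (b i)).toContinuousBilinearMap p.2.1 p.2.2 := fun p ↦ by
      conv_lhs => rw [← b.sum_repr p.1]
      simp only [map_sum, LinearMap.sum_apply, map_smul, LinearMap.smul_apply, smul_eq_mul]
      rfl
    simp only [h]
    have hb : ∀ i, Continuous (b.coord i) := fun i ↦ (b.coord i).continuous_of_finiteDimensional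
    fun_prop
  have hsurj : Function.Surjective A := by
    refine LinearMap.injective_iff_surjective.1 ((injective_iff_map_eq_zero A).2 fun v hv ↦ ?_)
    by_contra hne
    have := hAB v hne
    rw [hv, norm_zero] at this
    exact absurd this (norm_nonneg _).not_gt
  -- The zero space is separate: its unit sphere is empty, so there is no maximum to take.
  by_cases hV : Subsingleton V
  · ext x y z
    simp [Subsingleton.elim x 0]
  rw [not_subsingleton_iff_nontrivial] at hV
  set S := Metric.sphere (0 : V) 1
  have hS : IsCompact (S ×ˢ S ×ˢ S) :=
    (isCompact_sphere _ _).prod ((isCompact_sphere _ _).prod (isCompact_sphere _ _))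
  have hSne : S.Nonempty := NormedSpace.sphere_nonempty.2 zero_le_one
  obtain ⟨⟨x, y, z⟩, ⟨hx, hy, hz⟩, hmax⟩ :=
    hS.exists_isMaxOn (hSne.prod (hSne.prod hSne)) hcont.abs.continuousOn
  simp only [S, mem_sphere_zero_iff_norm] at hx hy hz
  have hbound : ∀ u v w, |T u v w| ≤ |T x y z| * (‖u‖ * ‖v‖ * ‖w‖) := by
    intro u v w
    rcases eq_or_ne u 0 with rfl | hu
    · simp
    rcases eq_or_ne v 0 with rfl | hv
    · simp
    rcases eq_or_ne w 0 with rfl | hw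
    · simp
    have := hmax (a := (‖u‖⁻¹ • u, ‖v‖⁻¹ • v, ‖w‖⁻¹ • w))
      ⟨by simp [S, norm_smul, hu], by simp [S, norm_smul, hv], by simp [S, norm_smul, hw]⟩
    simp only [Set.mem_ofPred_eq, map_smul, LinearMap.smul_apply, smul_eq_mul, abs_mul, abs_inv,
      abs_norm] at this
    have hu' := norm_pos_iff.2 hu
    have hv' := norm_pos_iff.2 hv
    have hw' := norm_pos_iff.2 hw
    calc |T u v w| = (‖u‖⁻¹ * (‖v‖⁻¹ * (‖w‖⁻¹ * |T u v w|))) * (‖u‖ * ‖v‖ * ‖w‖) := by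
          field_simp
      _ ≤ _ := by gcongr; linarith
  obtain ⟨x', rfl⟩ := hsurj x
  obtain ⟨y', rfl⟩ := hsurj y
  obtain ⟨z', rfl⟩ := hsurj z
  have hlt : ∀ v, ‖A v‖ = 1 → ‖B v‖ < 1 := by
    intro v hv
    rw [← hv]
    refine hAB v ?_
    rintro rfl
    simp at hv
  have hprod : ‖B x'‖ * ‖B y'‖ * ‖B z'‖ < 1 :=
    mul_lt_one_of_nonneg_of_lt_one_left (by positivity)
      (mul_lt_one_of_nonneg_of_lt_one_left (by positivity) (hlt _ hx) (hlt _ hy).le) (hlt _ hz).le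
  -- The maximum `m` satisfies `m = |T(Bx', By', Bz')| ≤ m * c` with `c < 1`.
  have hzero : |T (A x') (A y') (A z')| = 0 := by
    have h := hbound (B x') (B y') (B z')
    rw [← abs_neg (T (B x') _ _), ← hT] at h
    nlinarith [abs_nonneg (T (A x') (A y') (A z'))]
  ext u v w
  have h := hbound u v w
  rw [hzero, zero_mul] at h
  exact abs_nonpos_iff.1 h

/-- Let `J` be orthogonal with `J² = -1`, and let `I` be tamed by `⟪J·, ·⟫`. A trilinear form that
is the real part of a `J`-complex trilinear form and has no `(3,0)`-part with respect to `I`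
vanishes. -/
theorem trilinear_eq_zero_of_tamed [InnerProductSpace ℝ V] [FiniteDimensional ℝ V]
    (T : V →ₗ[ℝ] V →ₗ[ℝ] V →ₗ[ℝ] ℝ) (J I : V →ₗ[ℝ] V)
    (hJ : ∀ v, J (J v) = -v) (hJg : ∀ v w, inner ℝ (J v) (J w) = inner ℝ v w)
    (hI : ∀ v, v ≠ 0 → 0 < inner ℝ (J v) (I v))
    (hT₁ : ∀ x y z, T (J x) y z = T x (J y) z) (hT₂ : ∀ x y z, T x (J y) z = T x y (J z))
    (hTI : ∀ x y z, T x y z - T (I x) (I y) z - T (I x) y (I z) - T x (I y) (I z) = 0) :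
    T = 0 := by
  refine trilinear_eq_zero_of_norm_lt T (LinearMap.id - J ∘ₗ I) (LinearMap.id + J ∘ₗ I) ?_ ?_
  · intro v hv
    have h1 : inner ℝ v (J (I v)) = -inner ℝ (J v) (I v) := by
      rw [← hJg v, hJ, inner_neg_right]
    have h2 := norm_add_sq_real v (J (I v))
    have h3 := norm_sub_sq_real v (J (I v))
    have h4 := hI v hv
    simp only [LinearMap.add_apply, LinearMap.sub_apply, LinearMap.id_apply, LinearMap.comp_apply]
    refine lt_of_pow_lt_pow_left₀ 2 (norm_nonneg _) ?_
    rw [h2, h3, h1]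
    linarith
  · intro x y z
    -- In `T(Ax, Ay, Az) + T(Bx, By, Bz)` the terms odd in `JI` cancel. In the even ones two factors
    -- `J` combine to `-1`, leaving twice the expression in `hTI`.
    have h12 : ∀ a b c, T (J a) (J b) c = -T a b c := fun a b c ↦ by
      rw [hT₁, hJ]; simp
    have h23 : ∀ a b c, T a (J b) (J c) = -T a b c := fun a b c ↦ by
      rw [hT₂, hJ]; simp
    have h13 : ∀ a b c, T (J a) b (J c) = -T a b c := fun a b c ↦ by
      rw [← hT₂, h12]
    have h := hTI x y z
    simp only [LinearMap.add_apply, LinearMap.sub_apply, LinearMap.id_apply, LinearMap.comp_apply,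
      map_add, map_sub, h12, h23, h13]
    linarith

/-- The trilinear map underlying an alternating map in three variables. -/
noncomputable def AlternatingMap.toTrilinear {V : Type*} [AddCommGroup V] [Module ℝ V]
    (f : V [⋀^Fin 3]→ₗ[ℝ] ℝ) : V →ₗ[ℝ] V →ₗ[ℝ] V →ₗ[ℝ] ℝ where
  toFun x := LinearMap.mk₂ ℝ (fun y z ↦ f ![x, y, z])
    (fun a b z ↦ by simpa only [update_vec3_one] using f.map_update_add ![x, a, z] 1 a b)
    (fun c a z ↦ by simpa only [update_vec3_one] using f.map_update_smul ![x, a, z] 1 c a)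
    (fun y a b ↦ by simpa only [update_vec3_two] using f.map_update_add ![x, y, a] 2 a b)
    (fun c y a ↦ by simpa only [update_vec3_two] using f.map_update_smul ![x, y, a] 2 c a)
  map_add' a b := by
    ext y z
    simpa only [update_vec3_zero, LinearMap.mk₂_apply, LinearMap.add_apply, LinearMap.smul_apply,
      RingHom.id_apply] using f.map_update_add ![a, y, z] 0 a b
  map_smul' c a := by
    ext y z
    simpa only [update_vec3_zero, LinearMap.mk₂_apply, LinearMap.add_apply, LinearMap.smul_apply,
      RingHom.id_apply] using f.map_update_smul ![a, y, z] 0 c a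

end LinearAlgebra

/-! ### Integrability, the Nijenhuis tensor and the tensor `∇J`. -/

section AlmostComplex

variable {M : Type*} [TopologicalSpace M] [ChartedSpace E6 M] [IsManifold (𝓡 6) ∞ M]

/-- Lets identities between vector fields be read as identities between tangent vectors. -/
theorem exists_diffFieldAt_eq {x : M} (v : TangentSpace (𝓡 6) x) :
    ∃ X : ∀ y : M, TangentSpace (𝓡 6) y, DiffFieldAt X x ∧ X x = v :=
  ⟨FiberBundle.extend E6 v, FiberBundle.mdifferentiableAt_extend (𝓡 6) E6 v,
    FiberBundle.extend_apply_self E6 v⟩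

namespace AlmostComplexStructure

theorem diffFieldAt_applyField (J : AlmostComplexStructure M) {X : ∀ x : M, TangentSpace (𝓡 6) x}
    {x : M} (hX : DiffFieldAt X x) : DiffFieldAt (J.applyField X) x :=
  MDifferentiableAt.clm_bundle_apply ((J.contMDiff_toFun x).mdifferentiableAt (by simp)) hX

open VectorField in
/-- In a complex chart the Nijenhuis tensor is a combination of Lie brackets that cancel. -/
theorem lieBracket_complex_cancel {n : ℕ} (X Y : (Fin n → ℂ) → Fin n → ℂ)
    (p : Fin n → ℂ) :
    lieBracket ℝ (fun q ↦ Complex.I • X q) (fun q ↦ Complex.I • Y q) p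
      - Complex.I • lieBracket ℝ (fun q ↦ Complex.I • X q) Y p
      - Complex.I • lieBracket ℝ X (fun q ↦ Complex.I • Y q) p
      - lieBracket ℝ X Y p = 0 := by
  -- No differentiability is needed: `Z` and `iZ` are differentiable at the same points, and
  -- elsewhere both derivatives are `0` by convention.
  have key : ∀ Z : (Fin n → ℂ) → Fin n → ℂ, ∀ v,
      fderiv ℝ (fun q ↦ Complex.I • Z q) p v = Complex.I • fderiv ℝ Z p v := by
    intro Z v
    by_cases hZ : DifferentiableAt ℝ Z p
    · rw [fderiv_fun_const_smul hZ]; rfl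
    · have hZ' : ¬ DifferentiableAt ℝ (fun q ↦ Complex.I • Z q) p := by
        intro h
        apply hZ
        have e : Z = fun q ↦ (-Complex.I) • Complex.I • Z q := by
          funext q; simp [smul_smul]
        rw [e]
        exact h.const_smul (-Complex.I)
      rw [fderiv_zero_of_not_differentiableAt hZ, fderiv_zero_of_not_differentiableAt hZ']
      simp
  simp only [lieBracket, key, smul_sub, smul_smul, Complex.I_mul_I]
  module

-- Pulling back by the inverse chart respects brackets and turns `I` into multiplication by `i`,
-- where the four brackets cancel.
open VectorField in
theorem IsIntegrable.nijenhuisVanishes {I : AlmostComplexStructure M} (hI : I.IsIntegrable) :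
    I.NijenhuisVanishes := by
  have hmin : minSmoothness ℝ 2 ≤ ∞ := by simpa using ENat.LEInfty.out
  have : IsManifold (𝓡 6) (minSmoothness ℝ 2) M := IsManifold.of_le (n := ∞) hmin
  intro x X Y hX hY
  obtain ⟨φ, hx, hφ, hφ', hφI⟩ := hI x
  set f : (Fin 3 → ℂ) → M := fun q ↦ φ.symm q
  set p := φ x with hp
  have hpt : p ∈ φ.target := φ.map_source hx
  have hfp : f p = x := φ.left_inv hx
  have hfsmooth : ∀ q ∈ φ.target, ContMDiffAt 𝓘(ℝ, Fin 3 → ℂ) (𝓡 6) ∞ f q := fun q hq ↦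
    (hφ' q hq).contMDiffAt (φ.open_target.mem_nhds hq)
  have hφsmooth : ∀ y ∈ φ.source, ContMDiffAt (𝓡 6) 𝓘(ℝ, Fin 3 → ℂ) ∞ φ y := fun y hy ↦
    (hφ y hy).contMDiffAt (φ.open_source.mem_nhds hy)
  -- `mpullback` along `f` applies the inverse of `df`, which is `dφ`; this is where the hypothesis
  -- on `φ` enters.
  have hinv : ∀ q ∈ φ.target,
      (mfderiv 𝓘(ℝ, Fin 3 → ℂ) (𝓡 6) f q).inverse = mfderiv (𝓡 6) 𝓘(ℝ, Fin 3 → ℂ) φ (f q) ∧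
      (mfderiv 𝓘(ℝ, Fin 3 → ℂ) (𝓡 6) f q).IsInvertible := by
    intro q hq
    have hfq : f q ∈ φ.source := φ.map_target hq
    have d1 := (hfsmooth q hq).mdifferentiableAt (by simp)
    have d2 := (hφsmooth (f q) hfq).mdifferentiableAt (by simp)
    have c1 : (mfderiv (𝓡 6) 𝓘(ℝ, Fin 3 → ℂ) φ (f q)).comp
        (mfderiv 𝓘(ℝ, Fin 3 → ℂ) (𝓡 6) f q) = ContinuousLinearMap.id ℝ _ := by
      rw [← mfderiv_comp q d2 d1]
      have : φ ∘ f =ᶠ[nhds q] id := by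
        filter_upwards [φ.open_target.mem_nhds hq] with r hr using φ.right_inv hr
      rw [this.mfderiv_eq, mfderiv_id]
    have c2 : (mfderiv 𝓘(ℝ, Fin 3 → ℂ) (𝓡 6) f q).comp
        (mfderiv (𝓡 6) 𝓘(ℝ, Fin 3 → ℂ) φ (f q)) = ContinuousLinearMap.id ℝ _ := by
      have hq' : φ (f q) = q := φ.right_inv hq
      have d1' : MDifferentiableAt 𝓘(ℝ, Fin 3 → ℂ) (𝓡 6) f (φ (f q)) := by rwa [hq']
      have e := mfderiv_comp (f q) d1' d2
      rw [hq'] at e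
      rw [← e]
      have : f ∘ φ =ᶠ[nhds (f q)] id := by
        filter_upwards [φ.open_source.mem_nhds hfq] with r hr using φ.left_inv hr
      rw [this.mfderiv_eq, mfderiv_id]
    exact ⟨ContinuousLinearMap.inverse_eq c2 c1, .of_inverse c2 c1⟩
  set P : (∀ y : M, TangentSpace (𝓡 6) y) → (Fin 3 → ℂ) → Fin 3 → ℂ := fun X ↦
    mpullback 𝓘(ℝ, Fin 3 → ℂ) (𝓡 6) f X with hP
  have hPI : ∀ X, ∀ q ∈ φ.target, P (I.applyField X) q = Complex.I • P X q := by
    intro X q hq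
    simp only [hP, mpullback_apply, (hinv q hq).1]
    exact hφI _ (φ.map_target hq) _
  -- A bracket depends on germs, so equality at `p` alone would not suffice.
  have hPI' : ∀ X, P (I.applyField X) =ᶠ[nhds p] fun q ↦ Complex.I • P X q := fun X ↦ by
    filter_upwards [φ.open_target.mem_nhds hpt] with q hq using hPI X q hq
  have hbr : ∀ X Y : ∀ y : M, TangentSpace (𝓡 6) y, DiffFieldAt X x → DiffFieldAt Y x →
      P (mlieBracket (𝓡 6) X Y) p = lieBracket ℝ (P X) (P Y) p := by
    intro X Y hX hY
    rw [← hfp] at hX hY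
    have := mpullback_mlieBracket hX hY (hfsmooth p hpt) hmin
    rw [← mlieBracketWithin_univ (I := 𝓘(ℝ, Fin 3 → ℂ)), mlieBracketWithin_eq_lieBracketWithin]
      at this
    exact this.trans (congrFun lieBracketWithin_univ p)
  have hIX := I.diffFieldAt_applyField hX
  have hIY := I.diffFieldAt_applyField hY
  have hN : P (I.nijenhuis X Y) p = 0 := by
    have e : P (I.nijenhuis X Y) p = P (mlieBracket (𝓡 6) (I.applyField X) (I.applyField Y)) p
        - P (I.applyField (mlieBracket (𝓡 6) (I.applyField X) Y)) p
        - P (I.applyField (mlieBracket (𝓡 6) X (I.applyField Y))) p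
        - P (mlieBracket (𝓡 6) X Y) p := by
      simp only [hP, mpullback_apply, nijenhuis, applyField]
      erw [map_sub, map_sub, map_sub]
      rfl
    rw [e, hPI _ p hpt, hPI _ p hpt, hbr _ _ hIX hIY, hbr _ _ hIX hY, hbr _ _ hX hIY, hbr _ _ hX hY,
      (hPI' X).lieBracket_vectorField_eq (hPI' Y), (hPI' X).lieBracket_vectorField_eq .rfl,
      Filter.EventuallyEq.lieBracket_vectorField_eq .rfl (hPI' Y)]
    exact lieBracket_complex_cancel _ _ _
  -- The pullback at `p` is injective, so `N_I` itself vanishes at `x`.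
  obtain ⟨e, he⟩ := (hinv p hpt).2
  rw [hP] at hN
  simp only [mpullback_apply, ← he, ContinuousLinearMap.inverse_equiv] at hN
  rw [← hfp]
  exact (map_eq_zero_iff e.symm e.symm.injective).1 hN

/-- The terms containing `df` in the two Leibniz rules are both `df ⊗ JY` and cancel. -/
theorem tensorialAt_covDeriv (J : AlmostComplexStructure M)
    (nabla : CovariantDerivative (𝓡 6) E6 (fun x : M ↦ TangentSpace (𝓡 6) x)) (x : M) :
    TensorialAt (𝓡 6) E6 (fun Y : ∀ x : M, TangentSpace (𝓡 6) x ↦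
      nabla (J.applyField Y) x - (J x).comp (nabla Y x)) x where
  smul {f Y} hf hY := by
    have e : J.applyField (f • Y) = f • J.applyField Y := by
      funext y; simp [applyField]
    ext v
    rw [e, nabla.isCovariantDerivativeOn.leibniz (J.diffFieldAt_applyField hY) hf,
      nabla.isCovariantDerivativeOn.leibniz hY hf]
    simp [applyField, smul_sub]
  add {Y Z} hY hZ := by
    have e : J.applyField (Y + Z) = J.applyField Y + J.applyField Z := by
      funext y; simp [applyField]
    ext v
    rw [e, nabla.isCovariantDerivativeOn.add (J.diffFieldAt_applyField hY)
      (J.diffFieldAt_applyField hZ), nabla.isCovariantDerivativeOn.add hY hZ]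
    simp
    abel

/-- The tensor `(Y, X) ↦ (∇_X J) Y` at `x`. -/
noncomputable def covDerivTensor (J : AlmostComplexStructure M)
    (nabla : CovariantDerivative (𝓡 6) E6 (fun x : M ↦ TangentSpace (𝓡 6) x)) (x : M) :
    TangentSpace (𝓡 6) x →L[ℝ] TangentSpace (𝓡 6) x →L[ℝ] TangentSpace (𝓡 6) x :=
  TensorialAt.mkHom _ x (J.tensorialAt_covDeriv nabla x)

theorem covDerivTensor_apply (J : AlmostComplexStructure M)
    (nabla : CovariantDerivative (𝓡 6) E6 (fun x : M ↦ TangentSpace (𝓡 6) x)) {x : M}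
    {Y : ∀ x : M, TangentSpace (𝓡 6) x} (hY : DiffFieldAt Y x) (v : TangentSpace (𝓡 6) x) :
    J.covDerivTensor nabla x (Y x) v = J.covDeriv nabla x v Y :=
  congr($(TensorialAt.mkHom_apply (J.tensorialAt_covDeriv nabla x) hY) v)

/-- `∇_X J` anticommutes with `J`. -/
theorem covDerivTensor_apply_apply (J : AlmostComplexStructure M)
    (nabla : CovariantDerivative (𝓡 6) E6 (fun x : M ↦ TangentSpace (𝓡 6) x)) {x : M}
    (u v : TangentSpace (𝓡 6) x) :
    J.covDerivTensor nabla x (J x v) u = -J x (J.covDerivTensor nabla x v u) := by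
  obtain ⟨Y, hY, rfl⟩ := exists_diffFieldAt_eq v
  -- The anticommutation comes from differentiating `J(JY) = -Y`.
  have e : J.applyField (J.applyField Y) = (-1 : ℝ) • Y := by
    funext y
    simp [applyField, J.sq_eq_neg]
  have h := J.covDerivTensor_apply nabla (J.diffFieldAt_applyField hY) u
  rw [covDeriv, e, nabla.isCovariantDerivativeOn.smul_const _ hY] at h
  rw [J.covDerivTensor_apply nabla hY, covDeriv, map_sub, J.sq_eq_neg]
  refine Eq.trans h ?_
  simp
  abel

end AlmostComplexStructure

end AlmostComplex

/-! ### The exterior derivative of `ω` when `N_I = 0`, and the pure type case. -/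

section AlmostHermitian

variable {M : Type*} [TopologicalSpace M] [ChartedSpace E6 M] [IsManifold (𝓡 6) ∞ M]
  [RiemannianBundle (fun x : M ↦ TangentSpace (𝓡 6) x)]

namespace AlmostComplexStructure

/-- If `N_I = 0` and `ω` is `I`-invariant, then `dω` has no `(3,0)`-part with respect to `I`. -/
theorem dKahlerForm_eq_of_nijenhuisVanishes (J I : AlmostComplexStructure M)
    (hω : ∀ (x : M) (v w : TangentSpace (𝓡 6) x),
      J.kahlerForm x (I x v) (I x w) = J.kahlerForm x v w)
    (hN : I.NijenhuisVanishes) {X Y Z : ∀ x : M, TangentSpace (𝓡 6) x} {x : M}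
    (hX : DiffFieldAt X x) (hY : DiffFieldAt Y x) (hZ : DiffFieldAt Z x) :
    J.dKahlerForm X Y Z x - J.dKahlerForm (I.applyField X) (I.applyField Y) Z x
      - J.dKahlerForm (I.applyField X) Y (I.applyField Z) x
      - J.dKahlerForm X (I.applyField Y) (I.applyField Z) x = 0 := by
  have hadd : ∀ u v w, J.kahlerForm x (u + v) w = J.kahlerForm x u w + J.kahlerForm x v w :=
    fun u v w ↦ by simp only [kahlerForm, map_add, inner_add_left]
  have hshift : ∀ (y : M) (v w : TangentSpace (𝓡 6) y),
      J.kahlerForm y (I y v) w = -J.kahlerForm y v (I y w) := fun y v w ↦ by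
    rw [← hω y v (I y w), I.sq_eq_neg]
    simp only [kahlerForm, inner_neg_right, neg_neg]
  -- The derivative terms cancel in pairs by invariance of `ω`; the bracket terms then cancel by
  -- `N_I = 0`, in the form `hbr`.
  have hd₁ : ∀ U V W : ∀ x : M, TangentSpace (𝓡 6) x,
      J.derivKahlerForm U (I.applyField V) (I.applyField W) x = J.derivKahlerForm U V W x :=
    fun U V W ↦ by simp only [derivKahlerForm, applyField, hω]
  have hd₂ : ∀ U V W : ∀ x : M, TangentSpace (𝓡 6) x,
      J.derivKahlerForm U (I.applyField V) W x = -J.derivKahlerForm U V (I.applyField W) x :=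
    fun U V W ↦ by
      simp only [derivKahlerForm, applyField, hshift]
      rw [mvfderiv_fun_neg]
      rfl
  have hbr : ∀ U V W : ∀ x : M, TangentSpace (𝓡 6) x, DiffFieldAt U x → DiffFieldAt V x →
      J.kahlerForm x (VectorField.mlieBracket (𝓡 6) (I.applyField U) (I.applyField V) x) (W x) =
        J.kahlerForm x (VectorField.mlieBracket (𝓡 6) U V x) (W x)
        - J.kahlerForm x (VectorField.mlieBracket (𝓡 6) (I.applyField U) V x) (I.applyField W x)
        - J.kahlerForm x (VectorField.mlieBracket (𝓡 6) U (I.applyField V) x)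
          (I.applyField W x) := by
    intro U V W hU hV
    have h : VectorField.mlieBracket (𝓡 6) (I.applyField U) (I.applyField V) x =
        I x (VectorField.mlieBracket (𝓡 6) (I.applyField U) V x) +
        I x (VectorField.mlieBracket (𝓡 6) U (I.applyField V) x) +
        VectorField.mlieBracket (𝓡 6) U V x := by
      have := hN x U V hU hV
      rw [nijenhuis, sub_sub, sub_sub, sub_eq_zero] at this
      rw [this]; abel
    rw [h, hadd, hadd, hshift, hshift]
    simp only [applyField]
    ring
  simp only [dKahlerForm, hd₁, hd₂, hbr X Y Z hX hY, hbr X Z Y hX hZ, hbr Y Z X hY hZ]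
  ring

/-- If `N_I = 0` for some `I` tamed by `ω`, then `dω` vanishes wherever it is the real part of a
`J`-complex form. -/
theorem trilinear_eq_zero_of_eq_dKahlerForm {J I : AlmostComplexStructure M}
    (hJ : J.IsAlmostHermitian) (hI : I ∈ J.positiveTamed) (hN : I.NijenhuisVanishes) {x : M}
    (T : TangentSpace (𝓡 6) x →ₗ[ℝ] TangentSpace (𝓡 6) x →ₗ[ℝ] TangentSpace (𝓡 6) x →ₗ[ℝ] ℝ)
    (hT₁ : ∀ u v w, T (J x u) v w = T u (J x v) w) (hT₂ : ∀ u v w, T u (J x v) w = T u v (J x w))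
    (hT : ∀ X Y Z : ∀ x : M, TangentSpace (𝓡 6) x,
      DiffFieldAt X x → DiffFieldAt Y x → DiffFieldAt Z x →
        J.dKahlerForm X Y Z x = T (X x) (Y x) (Z x)) : T = 0 := by
  have : FiniteDimensional ℝ (TangentSpace (𝓡 6) x) := inferInstanceAs (FiniteDimensional ℝ E6)
  refine trilinear_eq_zero_of_tamed T (J x).toLinearMap (I x).toLinearMap (J.sq_eq_neg x) (hJ x)
    (hI.2.2 x) hT₁ hT₂ fun u v w ↦ ?_
  obtain ⟨X, hX, rfl⟩ := exists_diffFieldAt_eq u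
  obtain ⟨Y, hY, rfl⟩ := exists_diffFieldAt_eq v
  obtain ⟨Z, hZ, rfl⟩ := exists_diffFieldAt_eq w
  have h := J.dKahlerForm_eq_of_nijenhuisVanishes I hI.2.1 hN hX hY hZ
  have hIX := I.diffFieldAt_applyField hX
  have hIY := I.diffFieldAt_applyField hY
  have hIZ := I.diffFieldAt_applyField hZ
  rw [hT _ _ _ hX hY hZ, hT _ _ _ hIX hIY hZ, hT _ _ _ hIX hY hIZ, hT _ _ _ hX hIY hIZ] at h
  exact h

theorem not_nijenhuisVanishes_of_isPureType {J I : AlmostComplexStructure M}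
    (hJ : J.IsAlmostHermitian) (hpure : J.DKahlerFormIsPureType) (hne : J.DKahlerFormNeZero)
    (hI : I ∈ J.positiveTamed) : ¬ I.NijenhuisVanishes := by
  intro hN
  obtain ⟨x, X, Y, Z, hX, hY, hZ, h⟩ := hne
  obtain ⟨β, γ, hβ, hγ, hβγ⟩ := hpure x
  let T := (Complex.reLm.compAlternatingMap (β + γ)).toTrilinear
  have hTval : ∀ u v w, T u v w = (β ![u, v, w] + γ ![u, v, w]).re := fun _ _ _ ↦ rfl
  -- Inserting `J` in any slot multiplies `β` by `i` and `γ` by `-i`, so the result does not depend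
  -- on the slot.
  have h0 : ∀ u v w, T (J x u) v w = (Complex.I * β ![u, v, w] + -Complex.I * γ ![u, v, w]).re :=
    fun u v w ↦ by
      have e₁ := hβ ![u, v, w] 0
      have e₂ := hγ ![u, v, w] 0
      rw [update_vec3_zero] at e₁ e₂
      rw [hTval, ← e₁, ← e₂]; rfl
  have h1 : ∀ u v w, T u (J x v) w = (Complex.I * β ![u, v, w] + -Complex.I * γ ![u, v, w]).re :=
    fun u v w ↦ by
      have e₁ := hβ ![u, v, w] 1
      have e₂ := hγ ![u, v, w] 1
      rw [update_vec3_one] at e₁ e₂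
      rw [hTval, ← e₁, ← e₂]; rfl
  have h2 : ∀ u v w, T u v (J x w) = (Complex.I * β ![u, v, w] + -Complex.I * γ ![u, v, w]).re :=
    fun u v w ↦ by
      have e₁ := hβ ![u, v, w] 2
      have e₂ := hγ ![u, v, w] 2
      rw [update_vec3_two] at e₁ e₂
      rw [hTval, ← e₁, ← e₂]; rfl
  have hT : ∀ X Y Z : ∀ x : M, TangentSpace (𝓡 6) x,
      DiffFieldAt X x → DiffFieldAt Y x → DiffFieldAt Z x →
        J.dKahlerForm X Y Z x = T (X x) (Y x) (Z x) := fun X Y Z hX hY hZ ↦ by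
    rw [hTval, ← hβγ X Y Z hX hY hZ, Complex.ofReal_re]
  have hT0 : T = 0 := trilinear_eq_zero_of_eq_dKahlerForm hJ hI hN T
    (fun u v w ↦ by rw [h0, h1]) (fun u v w ↦ by rw [h1, h2]) hT
  exact h (by rw [hT X Y Z hX hY hZ, hT0]; rfl)

/-- The trilinear form `g((∇_X J) Y, Z)` at `x`. -/
noncomputable def covDerivForm (J : AlmostComplexStructure M)
    (nabla : CovariantDerivative (𝓡 6) E6 (fun x : M ↦ TangentSpace (𝓡 6) x)) (x : M) :
    TangentSpace (𝓡 6) x →ₗ[ℝ] TangentSpace (𝓡 6) x →ₗ[ℝ] TangentSpace (𝓡 6) x →ₗ[ℝ] ℝ where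
  toFun u := LinearMap.mk₂ ℝ (fun v w ↦ inner ℝ (J.covDerivTensor nabla x v u) w)
    (fun a b w ↦ by simp [inner_add_left])
    (fun c a w ↦ by simp [inner_smul_left])
    (fun v a b ↦ by simp [inner_add_right])
    (fun c v a ↦ by simp [inner_smul_right])
  map_add' a b := by
    ext v w
    simp [inner_add_left]
  map_smul' c a := by
    ext v w
    simp [inner_smul_left]

theorem covDerivForm_apply (J : AlmostComplexStructure M)
    (nabla : CovariantDerivative (𝓡 6) E6 (fun x : M ↦ TangentSpace (𝓡 6) x)) {x : M}
    (u v w : TangentSpace (𝓡 6) x) :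
    J.covDerivForm nabla x u v w = inner ℝ (J.covDerivTensor nabla x v u) w := rfl

end AlmostComplexStructure

end AlmostHermitian

/-! ### Nearly Kähler structures: `dω` in terms of `∇J`. -/

section NearlyKahler

variable {M : Type*} [TopologicalSpace M] [ChartedSpace E6 M] [IsManifold (𝓡 6) ∞ M]
  [RiemannianBundle (fun x : M ↦ TangentSpace (𝓡 6) x)]
  {nabla : CovariantDerivative (𝓡 6) E6 (fun x : M ↦ TangentSpace (𝓡 6) x)}

namespace AlmostComplexStructure

theorem IsAlmostHermitian.inner_apply_left {J : AlmostComplexStructure M}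
    (hJ : J.IsAlmostHermitian) {x : M} (v w : TangentSpace (𝓡 6) x) :
    inner ℝ (J x v) w = -inner ℝ v (J x w) := by
  rw [← hJ x v (J x w), J.sq_eq_neg, inner_neg_right, neg_neg]

theorem IsAlmostHermitian.kahlerForm_swap {J : AlmostComplexStructure M}
    (hJ : J.IsAlmostHermitian) {x : M} (v w : TangentSpace (𝓡 6) x) :
    J.kahlerForm x v w = -J.kahlerForm x w v := by
  simp only [kahlerForm]
  rw [hJ.inner_apply_left, real_inner_comm]

/-- Two signs cancel: `∇J` anticommutes with `J`, and `J` is skew for `g`. -/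
theorem IsAlmostHermitian.covDerivForm_apply_middle {J : AlmostComplexStructure M}
    (hJ : J.IsAlmostHermitian) {x : M} (u v w : TangentSpace (𝓡 6) x) :
    J.covDerivForm nabla x u (J x v) w = J.covDerivForm nabla x u v (J x w) := by
  rw [covDerivForm_apply, covDerivForm_apply, covDerivTensor_apply_apply, inner_neg_left,
    hJ.inner_apply_left, neg_neg]

/-- Polarization of `(∇_X J) X = 0`. -/
theorem IsStrictlyNearlyKahler.covDerivForm_swap {J : AlmostComplexStructure M}
    (hJ : J.IsStrictlyNearlyKahler nabla) {x : M} (u v w : TangentSpace (𝓡 6) x) :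
    J.covDerivForm nabla x u v w = -J.covDerivForm nabla x v u w := by
  have h : ∀ u, J.covDerivTensor nabla x u u = 0 := fun u ↦ by
    obtain ⟨X, hX, rfl⟩ := exists_diffFieldAt_eq u
    rw [J.covDerivTensor_apply nabla hX, hJ.covDeriv_self x X hX]
  have h' := h (u + v)
  simp only [map_add, add_apply, h, zero_add, add_zero] at h'
  rw [covDerivForm_apply, covDerivForm_apply, ← inner_neg_left, eq_neg_of_add_eq_zero_left h']

variable [IsContMDiffRiemannianBundle (𝓡 6) ∞ E6 (fun x : M ↦ TangentSpace (𝓡 6) x)]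

/-- Metric compatibility applied to `g(JY, Z)`, with `∇(JY)` split as `(∇J)Y + J∇Y`. -/
theorem derivKahlerForm_eq (J : AlmostComplexStructure M) (hnabla : IsLeviCivita nabla)
    {X Y Z : ∀ x : M, TangentSpace (𝓡 6) x} {x : M}
    (hY : DiffFieldAt Y x) (hZ : DiffFieldAt Z x) :
    J.derivKahlerForm X Y Z x = J.covDerivForm nabla x (X x) (Y x) (Z x)
      + J.kahlerForm x (nabla Y x (X x)) (Z x) + J.kahlerForm x (Y x) (nabla Z x (X x)) := by
  have : IsContMDiffRiemannianBundle (𝓡 6) 1 E6 (fun x : M ↦ TangentSpace (𝓡 6) x) :=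
    IsContMDiffRiemannianBundle.of_le (n := ∞) (by simp)
  have h := hnabla.1.mvfderiv_inner_eq X (J.diffFieldAt_applyField hY) hZ
  rw [covDerivForm_apply, J.covDerivTensor_apply nabla hY, covDeriv, inner_sub_left]
  simp only [derivKahlerForm, kahlerForm]
  refine Eq.trans h ?_
  simp only [applyField]
  ring

/-- `g((∇_X J) Y, Z)` is skew in `Y` and `Z`. -/
theorem IsAlmostHermitian.covDerivForm_swap {J : AlmostComplexStructure M}
    (hJ : J.IsAlmostHermitian) (hnabla : IsLeviCivita nabla) {x : M}
    (u v w : TangentSpace (𝓡 6) x) :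
    J.covDerivForm nabla x u v w = -J.covDerivForm nabla x u w v := by
  obtain ⟨X, hX, rfl⟩ := exists_diffFieldAt_eq u
  obtain ⟨Y, hY, rfl⟩ := exists_diffFieldAt_eq v
  obtain ⟨Z, hZ, rfl⟩ := exists_diffFieldAt_eq w
  have h₁ := J.derivKahlerForm_eq hnabla (X := X) hY hZ
  have h₂ := J.derivKahlerForm_eq hnabla (X := X) hZ hY
  have h₃ : J.derivKahlerForm X Y Z x = -J.derivKahlerForm X Z Y x := by
    have e : (fun y ↦ J.kahlerForm y (Y y) (Z y)) = fun y ↦ -J.kahlerForm y (Z y) (Y y) :=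
      funext fun y ↦ hJ.kahlerForm_swap _ _
    rw [derivKahlerForm, e, mvfderiv_fun_neg]
    rfl
  have h₄ := hJ.kahlerForm_swap (nabla Y x (X x)) (Z x)
  have h₅ := hJ.kahlerForm_swap (nabla Z x (X x)) (Y x)
  linarith

/-- `dω(X, Y, Z)` is the cyclic sum of `g((∇_X J) Y, Z)`. -/
theorem IsAlmostHermitian.dKahlerForm_eq {J : AlmostComplexStructure M}
    (hJ : J.IsAlmostHermitian) (hnabla : IsLeviCivita nabla)
    {X Y Z : ∀ x : M, TangentSpace (𝓡 6) x} {x : M}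
    (hX : DiffFieldAt X x) (hY : DiffFieldAt Y x) (hZ : DiffFieldAt Z x) :
    J.dKahlerForm X Y Z x = J.covDerivForm nabla x (X x) (Y x) (Z x)
      - J.covDerivForm nabla x (Y x) (X x) (Z x) + J.covDerivForm nabla x (Z x) (X x) (Y x) := by
  have htor : ∀ {U V : ∀ x : M, TangentSpace (𝓡 6) x}, DiffFieldAt U x → DiffFieldAt V x →
      nabla V x (U x) - nabla U x (V x) = VectorField.mlieBracket (𝓡 6) U V x :=
    (CovariantDerivative.torsion_eq_zero_iff nabla).1 hnabla.2
  have hsub : ∀ a b c, J.kahlerForm x (a - b) c = J.kahlerForm x a c - J.kahlerForm x b c :=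
    fun a b c ↦ by simp only [kahlerForm, map_sub, inner_sub_left]
  -- Vanishing torsion turns the brackets into differences of covariant derivatives, which cancel
  -- those coming from `derivKahlerForm_eq`.
  rw [dKahlerForm, J.derivKahlerForm_eq hnabla hY hZ, J.derivKahlerForm_eq hnabla hX hZ,
    J.derivKahlerForm_eq hnabla hX hY, ← htor hX hY, ← htor hX hZ, ← htor hY hZ, hsub, hsub, hsub,
    hJ.kahlerForm_swap (Y x), hJ.kahlerForm_swap (X x) (nabla Z x (Y x)),
    hJ.kahlerForm_swap (X x) (nabla Y x (Z x))]
  ring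

theorem IsStrictlyNearlyKahler.not_nijenhuisVanishes [Nonempty M] {J I : AlmostComplexStructure M}
    (hnabla : IsLeviCivita nabla) (hJ : J.IsStrictlyNearlyKahler nabla)
    (hI : I ∈ J.positiveTamed) : ¬ I.NijenhuisVanishes := by
  intro hN
  obtain ⟨x⟩ := ‹Nonempty M›
  have hH := hJ.isAlmostHermitian
  set P := J.covDerivForm nabla x with hP
  have h12 : ∀ u v w, P u v w = -P v u w := hJ.covDerivForm_swap
  have h23 : ∀ u v w, P u v w = -P u w v := hH.covDerivForm_swap hnabla
  have hm : ∀ u v w, P u (J x v) w = P u v (J x w) := hH.covDerivForm_apply_middle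
  -- `P` is totally skew, so moving `J` between the last two slots allows moving it between any two.
  have hl : ∀ u v w, P (J x u) v w = P u (J x v) w := fun u v w ↦ by
    rw [h12, h23, ← hm, h23, neg_neg, h12, neg_neg, ← hm]
  -- By skewness the three summands of `dω` are equal, whence the factor `3`.
  have hzero : (3 : ℝ) • P = 0 := by
    refine trilinear_eq_zero_of_eq_dKahlerForm hH hI hN _ (fun u v w ↦ ?_) (fun u v w ↦ ?_)
      fun X Y Z hX hY hZ ↦ ?_
    · simp only [LinearMap.smul_apply, hl]
    · simp only [LinearMap.smul_apply, hm]
    · rw [hH.dKahlerForm_eq hnabla hX hY hZ, ← hP, h12 (Y x), h12 (Z x), h23 (X x) (Z x)]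
      simp only [LinearMap.smul_apply, smul_eq_mul]
      ring
  have : Nontrivial (TangentSpace (𝓡 6) x) := inferInstanceAs (Nontrivial E6)
  obtain ⟨v, hv⟩ := exists_ne (0 : TangentSpace (𝓡 6) x)
  obtain ⟨Y, hY, hne⟩ := hJ.covDeriv_ne_zero x v hv
  rw [← J.covDerivTensor_apply nabla hY] at hne
  apply hne
  -- The squared norm of `(∇_v J) Y` is a value of `P`.
  rw [← inner_self_eq_zero (𝕜 := ℝ), ← covDerivForm_apply, ← hP,
    (smul_eq_zero.1 hzero).resolve_left (by norm_num)]
  rfl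

end AlmostComplexStructure

end NearlyKahler

theorem mainTheorem1 {M : Type*} [TopologicalSpace M] [T2Space M] [SecondCountableTopology M]
    [Nonempty M] [ChartedSpace E6 M] [IsManifold (𝓡 6) ∞ M]
    [RiemannianBundle (fun x : M ↦ TangentSpace (𝓡 6) x)]
    [IsContMDiffRiemannianBundle (𝓡 6) ∞ E6 (fun x : M ↦ TangentSpace (𝓡 6) x)]
    (J : AlmostComplexStructure M) :
    -- strictly nearly Kähler 6-manifolds
    (∀ nabla : CovariantDerivative (𝓡 6) E6 (fun x : M ↦ TangentSpace (𝓡 6) x),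
      IsLeviCivita nabla → J.IsStrictlyNearlyKahler nabla →
        ∀ I ∈ J.positiveTamed, ¬ I.IsIntegrable ∧ ¬ I.NijenhuisVanishes) ∧
    -- almost Hermitian 6-manifolds with `dω ≠ 0` of type `(3,0) + (0,3)`
    (J.IsAlmostHermitian → J.DKahlerFormIsPureType → J.DKahlerFormNeZero →
        ∀ I ∈ J.positiveTamed, ¬ I.IsIntegrable ∧ ¬ I.NijenhuisVanishes) := by
  refine ⟨fun nabla hnabla hJ I hI ↦ ?_, fun hJ hpure hne I hI ↦ ?_⟩
  · have h := hJ.not_nijenhuisVanishes hnabla hI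
    exact ⟨fun hint ↦ h hint.nijenhuisVanishes, h⟩
  · have h := AlmostComplexStructure.not_nijenhuisVanishes_of_isPureType hJ hpure hne hI
    exact ⟨fun hint ↦ h hint.nijenhuisVanishes, h⟩
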